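/- **Setting.** Let $L,k\ge 1$ be integers with $k\mid L$, let $N$ be an $L$-bit integer ($2^{L-1}\le N<2^L$), let $0<a<N$ with $\gcd(N,a)=1$, let $r$ be the multiplicative order of $a$ modulo $N$, and let $\varepsilon>0$. Put $$p=\Big\lceil \log_2\Big(2+\frac{k}{2\varepsilon}\Big)\Big\rceil,\qquad l_j=(j-1)\frac Lk+1\ (1\le j\le k),\quad l_{k+1}=2L,\qquad n_j=l_{j+1}+2-l_j,\quad t_j=n_j+p .$$ A $t$-bit string is identified with the integer in $[0,2^t)$ that it represents in binary; $x_{[i,j]}$ denotes the bits number $i,\dots,j$ of $x$, counted from $1$ starting with the most significant bit, and $\circ$ denotes concatenation. **Quantum part.** The system consists of registers $A_1,\dots,A_k$, where $A_j$ has $t_j$ qubits, and an $L$-qubit register $C$; its initial state is $|0\rangle_{A_1}\cdots|0\rangle_{A_k}|1\rangle_C$. Let $M_a|x\rangle=|ax\bmod N\rangle$ for $0\le x<N$ (and $M_a|x\rangle=|x\rangle$ for $N\le x<2^L$). For $u=1,\dots,k$ in this order, computer $u$ applies $H^{\otimes t_u}$ to $A_u$, then the controlled operation $|j\rangle_{A_u}|x\rangle_C\mapsto|j\rangle_{A_u}\big(M_a^{2^{l_u-1}}\big)^j|x\rangle_C$,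 then the inverse quantum Fourier transform $QFT^{-1}$ to $A_u$, where $QFT|x\rangle=2^{-t/2}\sum_{y=0}^{2^t-1}e^{2\pi i xy/2^t}|y\rangle$ on $t$ qubits; it then passes register $C$ to computer $u+1$ (by ideal teleportation). Finally, the first $n_j$ qubits of $A_j$ are measured in the computational basis, with result $m_j$, for $j=1,\dots,k-1$, and all qubits of $A_k$ are measured, with result $m_k$. **Classical part (CombineResults).** Put $m'_k=m_k$. For $u=k-1,k-2,\dots,1$, let $b_u\in\{-1,0,1\}$ be such that $$\big((m_u)_{[n_u-1,\,n_u]}+b_u\big)\bmod 4=(m'_{u+1})_{[1,2]}$$ (if no such $b_u$ exists, the procedure fails and has no output; otherwise $b_u$ is unique), and put $$m'_u=\big((m_u+b_u)\bmod 2^{n_u}\big)\circ (m'_{u+1})_{[3,\;2L+p+2-l_{u+1}]} .$$ The output is $m=m'_1$. **Theorem.** With probability at least $1-\varepsilon$, the algorithm outputs a $(2L+1+p)$-bit string $m$ for which there is an $s_0\in\{0,1,\dots,r-1\}$ with $$\left|\frac{m}{2^{2L+1+p}}-\frac{s_0}{r}\right|\le 2^{-(2L+1)} .$$ -/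

import Mathlib

noncomputable section

namespace DistributedOrderFinding

/-! ### Bit strings

A `t`-bit string is identified with the integer in `[0, 2 ^ t)` that it represents in binary;
positions are counted from `1`, starting with the most significant bit. -/

/-- The substring `x_{[i,j]}` (positions `i, i + 1, …, j`) of the `t`-bit string `x`. -/
def substr (t i j x : ℕ) : ℕ := x / 2 ^ (t - j) % 2 ^ (j + 1 - i)

/-- The concatenation `x ∘ y`, where `y` is an `n`-bit string. -/
def concat (n x y : ℕ) : ℕ := x * 2 ^ n + y

/-! ### Parameters of the distributed algorithm

Computers are numbered `1, …, k`; computer `j` estimates the fractional bits number `l j` to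
`l (j + 1) + 1` of `s / r`. -/

/-- `l_j = (j - 1) * (L / k) + 1` for `1 ≤ j ≤ k`, and `l_{k+1} = 2 * L`. -/
def l (L k j : ℕ) : ℕ := if j ≤ k then (j - 1) * (L / k) + 1 else 2 * L

/-- The length `l_{j+1} + 2 - l_j` of the block of bits that computer `j` is to estimate. -/
def blockLen (L k j : ℕ) : ℕ := l L k (j + 1) + 2 - l L k j

/-- The number `p = ⌈log₂ (2 + 1 / (2 ε'))⌉` of additional qubits, where `ε' = ε / k`. -/
def extraQubits (k : ℕ) (ε : ℝ) : ℕ := ⌈Real.logb 2 (2 + 1 / (2 * (ε / k)))⌉₊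

/-- The number `t_j = l_{j+1} + 2 - l_j + p` of qubits of register `A_j`. -/
def regSize (L k p j : ℕ) : ℕ := blockLen L k j + p

/-! ### Gates -/

/-- The `t`-fold tensor power of the Hadamard gate, on `t` qubits. -/
def hadamard (t : ℕ) : Matrix (Fin (2 ^ t)) (Fin (2 ^ t)) ℂ := fun y x =>
  ∏ i : Fin t, (1 / (√2 : ℂ)) *
    (if (y : ℕ).testBit i = true ∧ (x : ℕ).testBit i = true then -1 else 1)

/-- The quantum Fourier transform on `t` qubits. -/
def qft (t : ℕ) : Matrix (Fin (2 ^ t)) (Fin (2 ^ t)) ℂ := fun y x =>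
  (1 / (√(2 ^ t) : ℂ)) * Complex.exp (2 * Real.pi * Complex.I * x * y / 2 ^ t)

open Matrix in
/-- The inverse quantum Fourier transform on `t` qubits. -/
def qftInv (t : ℕ) : Matrix (Fin (2 ^ t)) (Fin (2 ^ t)) ℂ := (qft t)ᴴ

/-- `qftInv` is indeed the inverse of the quantum Fourier transform. -/
theorem qftInv_mul_qft (t : ℕ) : qftInv t * qft t = 1 := by
  ext x z
  have key : ∀ y : Fin (2 ^ t), qftInv t x y * qft t y z =
      (1 / 2 ^ t : ℂ) * Complex.exp (2 * Real.pi * Complex.I * ((z : ℂ) - x) / 2 ^ t) ^ (y : ℕ) := by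
    intro y
    have h1 : ((√(2 ^ t : ℝ) : ℝ) : ℂ) * (√(2 ^ t : ℝ) : ℝ) = 2 ^ t := by
      rw [← Complex.ofReal_mul, Real.mul_self_sqrt (by positivity)]; norm_num
    simp only [qftInv, qft, Matrix.conjTranspose_apply, star_mul', RCLike.star_def, map_div₀, map_one,
      Complex.conj_ofReal, ← Complex.exp_conj, map_mul, map_pow, map_ofNat, Complex.conj_I,
      map_natCast]
    rw [← Complex.exp_nat_mul, mul_mul_mul_comm, ← Complex.exp_add]
    congr 1
    · rw [← h1]; field_simp
    · congr 1; ring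
  rw [Matrix.mul_apply, Finset.sum_congr rfl (fun y _ => key y), ← Finset.mul_sum,
    Fin.sum_univ_eq_sum_range (fun n => Complex.exp (2 * Real.pi * Complex.I * ((z : ℂ) - x) / 2 ^ t) ^ n)]
  by_cases hxz : x = z
  · subst hxz
    simp
  · rw [Matrix.one_apply_ne hxz, geom_sum_eq]
    · rw [← Complex.exp_nat_mul]
      have : ((2 ^ t : ℕ) : ℂ) * (2 * Real.pi * Complex.I * ((z : ℂ) - x) / 2 ^ t) =
          (((z : ℤ) - (x : ℤ) : ℤ) : ℂ) * (2 * Real.pi * Complex.I) := by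
        push_cast; field_simp
      rw [this, Complex.exp_int_mul_two_pi_mul_I]; simp
    · intro h
      obtain ⟨n, hn⟩ := Complex.exp_eq_one_iff.1 h
      have h2 : (2 * Real.pi * Complex.I : ℂ) ≠ 0 := Complex.two_pi_I_ne_zero
      have h3 : ((z : ℂ) - x) = n * 2 ^ t := by
        rw [div_eq_iff (pow_ne_zero t (two_ne_zero : (2 : ℂ) ≠ 0))] at hn
        apply mul_left_cancel₀ h2
        rw [hn]; ring
      have h4 : ((z : ℤ) - (x : ℤ)) = n * 2 ^ t := by exact_mod_cast h3
      have hz := z.2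
      have hx := x.2
      have h5 : ((z : ℤ)) < 2 ^ t := by exact_mod_cast hz
      have h6 : ((x : ℤ)) < 2 ^ t := by exact_mod_cast hx
      have h7 : n = 0 := by
        have a1 : n < 1 := by nlinarith
        have a2 : -1 < n := by nlinarith
        omega
      apply hxz
      apply Fin.ext
      rw [h7] at h4
      omega

/-- The map `M_a |x⟩ = |a x mod N⟩` for `x < N` on an `L`-qubit register (where `N ≤ 2 ^ L`);
it fixes the remaining basis states `|x⟩`, `N ≤ x < 2 ^ L`. -/
def modMul (N a L : ℕ) : Matrix (Fin (2 ^ L)) (Fin (2 ^ L)) ℂ := fun y x =>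
  if (y : ℕ) = (if (x : ℕ) < N then a * x % N else (x : ℕ)) then 1 else 0

/-! ### The quantum part -/

/-- Labels of the computational basis states of the joint system: one bit string for each register
`A_1, …, A_k` (`A_j` sits at the index `j - 1` of `Fin k`) and one for the `L`-qubit
register `C`. -/
abbrev Basis (L k p : ℕ) : Type :=
  ((u : Fin k) → Fin (2 ^ regSize L k p (u + 1))) × Fin (2 ^ L)

/-- State vectors of the joint system, by their amplitudes in the computational basis. -/
abbrev State (L k p : ℕ) : Type := Basis L k p → ℂ

variable {L k p : ℕ}

/-- Apply `G` to register `A_{u+1}`, and the identity to all other registers. -/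
def applyGate (u : Fin k)
    (G : Matrix (Fin (2 ^ regSize L k p (u + 1))) (Fin (2 ^ regSize L k p (u + 1))) ℂ)
    (φ : State L k p) : State L k p := fun c =>
  ∑ y, G (c.1 u) y * φ (Function.update c.1 u y, c.2)

/-- Apply the controlled operation `|j⟩|x⟩ ↦ |j⟩ (U ^ j |x⟩)` to the registers `A_{u+1}` (control)
and `C` (target). -/
def applyControlled (u : Fin k) (U : Matrix (Fin (2 ^ L)) (Fin (2 ^ L)) ℂ)
    (φ : State L k p) : State L k p := fun c =>
  ∑ x, (U ^ (c.1 u : ℕ)) c.2 x * φ (c.1, x)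

/-- The initial state `|0⟩_{A_1} ⋯ |0⟩_{A_k} |1⟩_C`. -/
def initialState (L k p : ℕ) : State L k p := fun c =>
  if (∀ u, (c.1 u : ℕ) = 0) ∧ (c.2 : ℕ) = 1 then 1 else 0

/-- The operations of computer `A_{u+1}`: Hadamard gates on its register, then the controlled powers
of `M_a ^ (2 ^ (l_{u+1} - 1))` on register `C`, then the inverse quantum Fourier transform.
The (ideal) teleportation of register `C` to the next computer does not change the joint state. -/
def nodeStep (N a : ℕ) (u : Fin k) (φ : State L k p) : State L k p :=
  applyGate u (qftInv _)
    (applyControlled u (modMul N a L ^ 2 ^ (l L k (u + 1) - 1))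
      (applyGate u (hadamard _) φ))

/-- The state of the joint system before the measurement: the computers `A_1, …, A_k` act one after
another, in this order. -/
def finalState (N a L k p : ℕ) : State L k p :=
  (List.finRange k).foldl (fun φ u => nodeStep N a u φ) (initialState L k p)

/-- The measuring results `m_1, …, m_k` (indexed from `1`, and `0` at the other indices) read off from
a basis state: the first `l_{j+1} + 2 - l_j` bits of register `A_j` if `j < k`, and all bits of
register `A_k`. -/
def readout (c : Basis L k p) (j : ℕ) : ℕ :=
  if h : 1 ≤ j ∧ j ≤ k then
    if j < k then
      substr (regSize L k p j) 1 (blockLen L k j) (c.1 ⟨j - 1, by omega⟩)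
    else c.1 ⟨j - 1, by omega⟩
  else 0

open Classical in
/-- The probability (Born's rule, for the measurement in the computational basis) that the results
of measuring the state `φ` have the property `E`. -/
def prob (φ : State L k p) (E : (ℕ → ℕ) → Prop) : ℝ :=
  ∑ c : Basis L k p with E (readout c), ‖φ c‖ ^ 2

/-! ### The classical part -/

/-- The correction bit: the `b ∈ {-1, 0, 1}` with `(x + b) mod 2 ^ 2 = y`, if there is one. -/
def correctionBit (x y : ℕ) : Option ℤ :=
  [-1, 0, 1].find? fun b => decide (((x : ℤ) + b) % 2 ^ 2 = (y : ℤ))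

/-- One round of the correction: from `x = m_u` and `y = m'_{u+1}` compute `m'_u`, or fail if there is
no correction bit. Here `x` has `n = l_{u+1} + 2 - l_u` bits, its last two bits are compared
with the first two bits of `y`, and `y` has `n' = 2 L + p + 2 - l_{u+1}` bits. -/
def correct (L k p u x y : ℕ) : Option ℕ :=
  let n := blockLen L k u
  let n' := 2 * L + p + 2 - l L k (u + 1)
  (correctionBit (substr n (n - 1) n x) (substr n' 1 2 y)).map fun b =>
    concat (n' - 2) (((x : ℤ) + b) % 2 ^ n).toNat (substr n' 3 n' y)

/-- `corrected L k p m i` is `m'_{k-i}`: it starts with `m'_k = m_k`, and `m'_u` is computed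
from `m_u` and `m'_{u+1}`. -/
def corrected (L k p : ℕ) (m : ℕ → ℕ) : ℕ → Option ℕ
  | 0 => some (m k)
  | i + 1 => (corrected L k p m i).bind fun y => correct L k p (k - (i + 1)) (m (k - (i + 1))) y

/-- The classical program `CombineResults`: its output is `m'_1`; it fails (`none`) if in some round
there is no correction bit. -/
def combineResults (L k p : ℕ) (m : ℕ → ℕ) : Option ℕ := corrected L k p m (k - 1)

/-- `m` is a `(2 L + 1 + p)`-bit string that estimates `s / r` for some `s ∈ {0, …, r - 1}` up to an
error of at most `2 ^ (-(2 L + 1))`. -/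
def IsGoodEstimate (L p r m : ℕ) : Prop :=
  m < 2 ^ (2 * L + 1 + p) ∧ ∃ s₀ : ℕ, s₀ < r ∧
    |(m : ℝ) / 2 ^ (2 * L + 1 + p) - (s₀ : ℝ) / r| ≤ 1 / 2 ^ (2 * L + 1)

end DistributedOrderFinding

end

namespace DistributedOrderFinding

/-! ### Parameters -/

/-! Quantum side. The state `|1⟩` of register C is the sum of r orthogonal eigenvectors of `M_a`,
with eigenvalues `exp (2πi s/r)` and squared norm 1/r (`sum_eigenvector`, `eigenvector_orthogonal`).
All computers apply powers of the same operator, so on each eigenvector they perform independent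
phase estimations with one common s (`foldl_nodeStep_prodState`). C is not measured, so different s
do not interfere: the outcome law is the uniform mixture over s of product laws (`prob_finalState`).
Each register misses its phase by `2 ^ p` or more with probability at most `1 / (2 (2 ^ p - 1)) ≤ ε
/ k` (`sum_norm_phaseAmp_sq_le`, `two_add_le_two_pow_extraQubits`), and Bernoulli's inequality
bounds the probability that all k are accurate below by `1 - ε`.

Classical side. When all registers are accurate for the same s, the last one determines an integer Z
close to `2 ^ (2L+1+p) * s / r`, known modulo a power of two. The invariant is that `m'_u` consists
of the low bits of this fixed Z (`corrected_eq_some`): the block measured by computer u is off by at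
most 1 from the corresponding bits of Z (`abs_ediv_sub_ediv_le`), and two overlapping bits suffice
to detect such an error. Finally `m'_1 = Z`. No wraparound occurs: for 0 < s < r, s/r is far enough
from 0 and 1, and for s = 0 the estimate is exact. -/

theorem l_pos (L k j : ℕ) (hj : j ≤ k) : 1 ≤ l L k j := by
  simp [l, hj]

theorem l_succ_of_eq (L k : ℕ) : l L k (k + 1) = 2 * L := by
  simp [l]

/-- Every block starts within the first L bits. At least L + p bits of the final string then lie
below each overlap, enough to resolve fractions with denominator r < 2 ^ L. -/
theorem l_le {L k j : ℕ} (hL : 0 < L) (hkL : k ∣ L) (hj : 1 ≤ j) (hjk : j ≤ k) : l L k j ≤ L := by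
  have hq : 1 ≤ L / k := Nat.div_pos (Nat.le_of_dvd hL hkL) (by omega)
  have h1 : k * (L / k) = L := Nat.mul_div_cancel' hkL
  have h2 : (j - 1 + 1) * (L / k) ≤ k * (L / k) := Nat.mul_le_mul_right _ (by omega)
  simp only [l, hjk, if_true]
  rw [add_mul] at h2
  omega

theorem l_le_succ {L k j : ℕ} (hL : 0 < L) (hkL : k ∣ L) (hj : 1 ≤ j) (hjk : j ≤ k) :
    l L k j ≤ l L k (j + 1) := by
  rcases hjk.eq_or_lt with rfl | hlt
  · rw [l_succ_of_eq]
    have := l_le hL hkL hj le_rfl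
    omega
  · have h2 : (j - 1) * (L / k) ≤ (j + 1 - 1) * (L / k) := Nat.mul_le_mul_right _ (by omega)
    simp only [l, hjk, Nat.succ_le_of_lt hlt, if_true]
    omega

/-! ### The classical part -/

/-- The candidates -1, 0, 1 are incongruent modulo 4, so the search cannot stop before the given b.
-/
theorem correctionBit_eq_some {x y : ℕ} {b : ℤ} (hb : b = -1 ∨ b = 0 ∨ b = 1)
    (h : ((x : ℤ) + b) % 4 = y) : correctionBit x y = some b := by
  have h4 : (2 : ℤ) ^ 2 = 4 := by norm_num
  simp only [correctionBit, h4, List.find?_cons]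
  rcases hb with rfl | rfl | rfl
  · simp [h]
  · have h1 : ¬ ((x : ℤ) + -1) % 4 = y := by omega
    simp only [h1, h, decide_true, decide_false]
  · have h1 : ¬ ((x : ℤ) + -1) % 4 = y := by omega
    have h2 : ¬ ((x : ℤ) + 0) % 4 = y := by omega
    simp only [h1, h2, h, decide_true, decide_false]

/-- Mixed-radix expansion; for powers of two it separates the low bits from the block above them,
which is what `concat` reassembles. -/
theorem emod_mul_eq (Z a b : ℤ) (ha : 0 < a) (hb : 0 < b) :
    Z % (a * b) = Z % a + a * (Z / a % b) := by
  have h1 := Int.mul_ediv_add_emod Z a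
  have h2 := Int.mul_ediv_add_emod (Z / a) b
  have h3 := Int.emod_nonneg Z ha.ne'
  have h4 := Int.emod_lt_of_pos Z ha
  have h5 := Int.emod_nonneg (Z / a) hb.ne'
  have h6 := Int.emod_lt_of_pos (Z / a) hb
  have h7 : Z = (Z % a + a * (Z / a % b)) + a * b * (Z / a / b) := by
    linear_combination - h1 - a * h2
  conv_lhs => rw [h7, Int.add_mul_emod_self_left]
  apply Int.emod_eq_of_lt
  · positivity
  · nlinarith

/-- One round preserves the invariant that the current string is a residue of Z: reduced modulo 4,
the congruence for x + b identifies b as the correction bit; modulo the full block length, it says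
that the corrected block carries the bits of Z above position q. -/
theorem correct_eq_some {L k p u x q : ℕ} {Z b : ℤ}
    (hq : 2 * L + p + 2 - l L k (u + 1) = q + 2) (hn : 2 ≤ blockLen L k u)
    (hb : b = -1 ∨ b = 0 ∨ b = 1) (h : ((x : ℤ) + b) ≡ Z / 2 ^ q [ZMOD 2 ^ blockLen L k u]) :
    correct L k p u x (Z % 2 ^ (q + 2)).toNat = some (Z % 2 ^ (blockLen L k u + q)).toNat := by
  have hq0 : (0 : ℤ) < 2 ^ q := by positivity
  have hpow : (2 : ℤ) ^ (q + 2) = 2 ^ q * 4 := by ring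
  have hZ := emod_mul_eq Z (2 ^ q) 4 hq0 (by norm_num)
  have hR0 := Int.emod_nonneg Z hq0.ne'
  have hRlt := Int.emod_lt_of_pos Z hq0
  have hY0 : 0 ≤ Z % 2 ^ (q + 2) := Int.emod_nonneg _ (by positivity)
  obtain ⟨y, hy⟩ := Int.eq_ofNat_of_zero_le hY0
  have hdiv : ((y / 2 ^ q : ℕ) : ℤ) = Z / 2 ^ q % 4 := by
    push_cast
    rw [← hy, hpow, hZ, Int.add_mul_ediv_left _ _ hq0.ne', Int.ediv_eq_zero_of_lt hR0 hRlt, zero_add]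
  have hmod : ((y % 2 ^ q : ℕ) : ℤ) = Z % 2 ^ q := by
    push_cast
    rw [← hy, hpow, Int.emod_emod_of_dvd _ (dvd_mul_right _ _)]
  have hbit : correctionBit (substr (blockLen L k u) (blockLen L k u - 1) (blockLen L k u) x)
      (substr (q + 2) 1 2 y) = some b := by
    apply correctionBit_eq_some hb
    have e1 : blockLen L k u + 1 - (blockLen L k u - 1) = 2 := by omega
    have e2 : q + 2 - 2 = q := by omega
    simp only [substr, e1, e2, Nat.sub_self, pow_zero, Nat.div_one]
    have h4 : ((x : ℤ) + b) ≡ Z / 2 ^ q [ZMOD 4] := by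
      apply h.of_dvd
      exact pow_dvd_pow (2 : ℤ) hn
    have h5 : ((x : ℤ) + b) % 4 = Z / 2 ^ q % 4 := h4
    push_cast at hdiv ⊢
    rw [hdiv]
    norm_num
    omega
  simp only [correct, hq, hy, Int.toNat_natCast, hbit, Option.map_some, Option.some.injEq]
  have e2 : q + 2 - 2 = q := by omega
  have e3 : q + 2 + 1 - 3 = q := by omega
  simp only [concat, substr, e2, e3, Nat.sub_self, pow_zero, Nat.div_one]
  have h6 : ((x : ℤ) + b) % 2 ^ blockLen L k u = Z / 2 ^ q % 2 ^ blockLen L k u := h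
  zify
  rw [Int.toNat_of_nonneg (Int.emod_nonneg _ (by positivity)),
    Int.toNat_of_nonneg (Int.emod_nonneg _ (by positivity)), h6]
  push_cast at hmod
  rw [hmod, pow_add, mul_comm (2 ^ blockLen L k u : ℤ),
    emod_mul_eq Z (2 ^ q) (2 ^ blockLen L k u) hq0 (by positivity)]
  ring

/-- If `C` approximates `2 ^ p * (A / r)` up to an error below `2 ^ p` and `Z` approximates
`2 ^ q * (A / r)` up to an error below `2 ^ q / r`, then the integral parts of `C / 2 ^ p` and
`Z / 2 ^ q` differ by at most `1`. -/
theorem abs_ediv_sub_ediv_le {r A C Z : ℤ} {p q : ℕ} (hr : 0 < r)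
    (hC : |r * C - 2 ^ p * A| < r * 2 ^ p) (hZ : |r * Z - 2 ^ q * A| < 2 ^ q) :
    |Z / 2 ^ q - C / 2 ^ p| ≤ 1 := by
  have hp0 : (0 : ℤ) < 2 ^ p := by positivity
  have hq0 : (0 : ℤ) < 2 ^ q := by positivity
  obtain ⟨hC1, hC2⟩ := abs_lt.1 hC
  obtain ⟨hZ1, hZ2⟩ := abs_lt.1 hZ
  set F := Z / 2 ^ q with hF
  set W := C / 2 ^ p with hW
  have hF1 : F * 2 ^ q ≤ Z := Int.ediv_mul_le _ hq0.ne'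
  have hF2 : Z < (F + 1) * 2 ^ q := Int.lt_ediv_add_one_mul_self _ hq0
  have hW1 : W * 2 ^ p ≤ C := Int.ediv_mul_le _ hp0.ne'
  have hW2 : C < (W + 1) * 2 ^ p := Int.lt_ediv_add_one_mul_self _ hp0
  -- As all terms are integers, `a1` and `a2` mean r F ≤ A ≤ r (F + 1). This sharpening, due to the
  -- error of Z being below 1 / r, is what limits the difference to 1 instead of 2.
  have a1 : r * F < A + 1 := by
    refine lt_of_mul_lt_mul_right ?_ hq0.le
    nlinarith [mul_le_mul_of_nonneg_left hF1 hr.le]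
  have a2 : A - 1 < r * (F + 1) := by
    refine lt_of_mul_lt_mul_right ?_ hq0.le
    nlinarith [mul_lt_mul_of_pos_left hF2 hr]
  have a3 : r * W < A + r := by
    refine lt_of_mul_lt_mul_right ?_ hp0.le
    nlinarith [mul_le_mul_of_nonneg_left hW1 hr.le]
  have a4 : A - r < r * (W + 1) := by
    refine lt_of_mul_lt_mul_right ?_ hp0.le
    nlinarith [mul_lt_mul_of_pos_left hW2 hr]
  have a5 : W < F + 2 := lt_of_mul_lt_mul_left (by linarith : r * W < r * (F + 2)) hr.le
  have a6 : F - 1 < W + 1 := lt_of_mul_lt_mul_left (by linarith : r * (F - 1) < r * (W + 1)) hr.le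
  rw [abs_le]
  constructor <;> linarith

/-- The result `c` of estimating the phase `s / r` with `t` qubits from the fractional bit number
`l` on is correct up to an error below `2 ^ p` (modulo `2 ^ t`), and exact if `s = 0`. -/
def IsAccurate (r s l p t c : ℕ) : Prop :=
  ∃ C : ℤ, C ≡ c [ZMOD 2 ^ t] ∧ |(r : ℤ) * C - 2 ^ (t + l - 1) * s| < r * 2 ^ p ∧ (s = 0 → C = 0)

/-- Downward induction over the computers with one fixed Z, taken from the last register; the other
registers only have to supply the bits of Z preceding those already known. -/
theorem corrected_eq_some {L k p r s : ℕ} (hL : 0 < L) (hkL : k ∣ L) (hr : 0 < r)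
    (hrL : r < 2 ^ L) (c : Basis L k p)
    (hc : ∀ u : Fin k, IsAccurate r s (l L k (u + 1)) p (regSize L k p (u + 1)) (c.1 u)) {Z : ℤ}
    (hZk : (Z % 2 ^ (2 * L + p + 2 - l L k k)).toNat = readout c k)
    (hZ : |(r : ℤ) * Z - 2 ^ (2 * L + 1 + p) * s| < r * 2 ^ p) (i : ℕ) (hi : i < k) :
    corrected L k p (readout c) i = some (Z % 2 ^ (2 * L + p + 2 - l L k (k - i))).toNat := by
  induction i with
  | zero => simp [corrected, hZk]
  | succ i ih =>
    specialize ih (by omega)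
    obtain ⟨u, hu⟩ : ∃ u, u = k - (i + 1) := ⟨_, rfl⟩
    have hu1 : k - i = u + 1 := by omega
    have hl1 := l_le hL hkL (j := u + 1) (by omega) (by omega)
    have hl0 := l_le_succ hL hkL (j := u) (by omega) (by omega)
    have hlp := l_pos L k u (by omega)
    obtain ⟨q, hq⟩ : ∃ q, q = 2 * L + p - l L k (u + 1) := ⟨_, rfl⟩
    have hq2 : 2 * L + p + 2 - l L k (u + 1) = q + 2 := by omega
    have hn : blockLen L k u + l L k u = l L k (u + 1) + 2 := by
      simp only [blockLen]; omega
    have hn2 : 2 ≤ blockLen L k u := by omega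
    have hreg : regSize L k p u = p + blockLen L k u := by simp only [regSize]; omega
    simp only [corrected, ih, Option.bind_some, ← hu, hu1, hq2]
    obtain ⟨C, hC1, hC2, -⟩ := hc ⟨u - 1, by omega⟩
    simp only [show u - 1 + 1 = u by omega] at hC1 hC2
    have hlast : 2 * L + p + 2 - l L k u = blockLen L k u + q := by omega
    rw [hlast]
    -- The overlap ends at fractional bit `l (u + 1) + 1` of s / r, so both numbers are compared
    -- with A / r for A = 2 ^ (l (u + 1) + 1) * s. The bound uses r < 2 ^ L and q ≥ L + p.
    have hZ' : |(r : ℤ) * Z - 2 ^ q * (2 ^ (l L k (u + 1) + 1) * s)| < 2 ^ q := by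
      rw [← mul_assoc, ← pow_add, show q + (l L k (u + 1) + 1) = 2 * L + 1 + p by omega]
      refine hZ.trans_le ?_
      calc (r : ℤ) * 2 ^ p ≤ 2 ^ L * 2 ^ p :=
            mul_le_mul_of_nonneg_right (by exact_mod_cast hrL.le) (by positivity)
        _ = 2 ^ (L + p) := by rw [pow_add]
        _ ≤ 2 ^ q := pow_le_pow_right₀ (by norm_num) (by omega)
    have hC' : |(r : ℤ) * C - 2 ^ p * (2 ^ (l L k (u + 1) + 1) * s)| < r * 2 ^ p := by
      rw [← mul_assoc, ← pow_add]
      rwa [hreg, show p + blockLen L k u + l L k u - 1 = p + (l L k (u + 1) + 1) by omega] at hC2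
    have hb := abs_ediv_sub_ediv_le (by exact_mod_cast hr) hC' hZ'
    -- The correction is the difference between the true block and the one read off from the
    -- representative C; passing from C to the measured value only changes the block modulo its
    -- length.
    refine correct_eq_some (b := Z / 2 ^ q - C / 2 ^ p) hq2 hn2 ?_ ?_
    · rw [abs_le] at hb; omega
    · have hm : ((readout c u : ℕ) : ℤ) ≡ C / 2 ^ p [ZMOD 2 ^ blockLen L k u] := by
        rw [readout, dif_pos ⟨by omega, by omega⟩, if_pos (by omega)]
        simp only [substr, regSize, Nat.add_sub_cancel_left, Nat.add_sub_cancel]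
        push_cast
        refine (Int.mod_modEq _ _).trans ?_
        obtain ⟨e, he⟩ := hC1.dvd
        have hp0 : (0 : ℤ) < 2 ^ p := by positivity
        have h2 : (((c.1 ⟨u - 1, by omega⟩ : ℕ)) : ℤ) = C + 2 ^ p * (2 ^ blockLen L k u * e) := by
          rw [hreg, pow_add] at he
          linear_combination he
        rw [h2, Int.add_mul_ediv_left _ _ hp0.ne']
        exact Int.modEq_iff_dvd.2 ⟨-e, by ring⟩
      have := hm.add_right (Z / 2 ^ q - C / 2 ^ p)
      simpa using this

theorem combineResults_isGoodEstimate {L k p r s : ℕ} (hL : 0 < L) (hk : 0 < k) (hkL : k ∣ L)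
    (hrL : r < 2 ^ L) (hs : s < r) (c : Basis L k p)
    (hc : ∀ u : Fin k, IsAccurate r s (l L k (u + 1)) p (regSize L k p (u + 1)) (c.1 u)) :
    ∃ m, combineResults L k p (readout c) = some m ∧ IsGoodEstimate L p r m := by
  have hr : 0 < r := by omega
  obtain ⟨Z, hZ1, hZ2, hZ0⟩ := hc ⟨k - 1, by omega⟩
  simp only [show k - 1 + 1 = k by omega] at hZ1 hZ2
  have hlk := l_le hL hkL hk le_rfl
  have hlp := l_pos L k k le_rfl
  have hreg : regSize L k p k = 2 * L + p + 2 - l L k k := by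
    simp only [regSize, blockLen, l_succ_of_eq]; omega
  rw [show regSize L k p k + l L k k - 1 = 2 * L + 1 + p by omega] at hZ2
  have hk' : (Z % 2 ^ (2 * L + p + 2 - l L k k)).toNat = readout c k := by
    rw [readout, dif_pos ⟨hk, le_rfl⟩, if_neg (lt_irrefl _), ← hreg, hZ1]
    have h3 := (c.1 ⟨k - 1, by omega⟩).2
    simp only [show k - 1 + 1 = k by omega] at h3
    rw [Int.emod_eq_of_lt (by positivity) (by exact_mod_cast h3), Int.toNat_natCast]
  have hcor := corrected_eq_some hL hkL hr hrL c hc hk' hZ2 (k - 1) (by omega)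
  have hl1 : l L k (k - (k - 1)) = 1 := by
    rw [show k - (k - 1) = 1 by omega]; simp [l, hk.ne']
  rw [hl1, show 2 * L + p + 2 - 1 = 2 * L + 1 + p by omega] at hcor
  have hT : (2 : ℤ) ^ (2 * L + 1 + p) = 2 ^ (L + 1) * (2 ^ L * 2 ^ p) := by ring
  have hrp : (r : ℤ) * 2 ^ p < 2 ^ L * 2 ^ p :=
    mul_lt_mul_of_pos_right (by exact_mod_cast hrL) (by positivity)
  have hTp : (2 : ℤ) ^ L * 2 ^ p ≤ 2 ^ (2 * L + 1 + p) := by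
    rw [hT]
    exact le_mul_of_one_le_left (by positivity) (one_le_pow₀ (by norm_num))
  have hr' : (0 : ℤ) < r := by exact_mod_cast hr
  have hT0 : (0 : ℤ) < 2 ^ (2 * L + 1 + p) := by positivity
  -- For 0 < s < r the target is at least 2 ^ (2L+1+p) / r > 2 ^ p away from both ends of the range.
  -- For s = 0 a negative Z would wrap around to an estimate near 1; exactness excludes it.
  have hrange : 0 ≤ Z ∧ Z < 2 ^ (2 * L + 1 + p) := by
    rcases Nat.eq_zero_or_pos s with h0 | h0
    · rw [hZ0 h0]; exact ⟨le_rfl, hT0⟩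
    · obtain ⟨h1, h2⟩ := abs_lt.1 hZ2
      have hs1 : (1 : ℤ) ≤ s := by exact_mod_cast h0
      have hs2 : (s : ℤ) ≤ r - 1 := by
        have : (s : ℤ) < r := by exact_mod_cast hs
        linarith
      constructor
      · refine (pos_of_mul_pos_right (b := Z) ?_ hr'.le).le
        nlinarith
      · refine lt_of_mul_lt_mul_left (a := (r : ℤ)) ?_ hr'.le
        nlinarith
  rw [Int.emod_eq_of_lt hrange.1 hrange.2] at hcor
  refine ⟨Z.toNat, hcor, ?_, s, hs, ?_⟩
  · zify
    rw [Int.toNat_of_nonneg hrange.1]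
    exact hrange.2
  · have hcast : ((Z.toNat : ℕ) : ℝ) = (Z : ℝ) := by
      exact_mod_cast congrArg (Int.cast (R := ℝ)) (Int.toNat_of_nonneg hrange.1)
    have hrR : (0 : ℝ) < r := by exact_mod_cast hr
    have hZR : |(r : ℝ) * Z - 2 ^ (2 * L + 1 + p) * s| ≤ r * 2 ^ p := by exact_mod_cast hZ2.le
    have hTR : (0 : ℝ) < 2 ^ (2 * L + 1 + p) := by positivity
    rw [hcast, show (Z : ℝ) / 2 ^ (2 * L + 1 + p) - s / r =
      (r * Z - 2 ^ (2 * L + 1 + p) * s) / (r * 2 ^ (2 * L + 1 + p)) by field_simp, abs_div,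
      abs_of_pos (mul_pos hrR hTR), div_le_div_iff₀ (mul_pos hrR hTR) (by positivity)]
    calc _ ≤ (r : ℝ) * 2 ^ p * 2 ^ (2 * L + 1) := by gcongr
      _ = _ := by ring

open Finset ComplexConjugate

noncomputable section

/-! ### Roots of unity -/

/-- The point `exp (2 π i x)` of the unit circle. -/
def unitExp (x : ℝ) : ℂ := Complex.exp ((2 * Real.pi * x : ℝ) * Complex.I)

theorem unitExp_add (x y : ℝ) : unitExp (x + y) = unitExp x * unitExp y := by
  rw [unitExp, unitExp, unitExp, ← Complex.exp_add]
  congr 1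
  push_cast
  ring

@[simp] theorem unitExp_zero : unitExp 0 = 1 := by
  simp [unitExp]

theorem unitExp_nat_mul (n : ℕ) (x : ℝ) : unitExp (n * x) = unitExp x ^ n := by
  rw [unitExp, unitExp, ← Complex.exp_nat_mul]
  congr 1
  push_cast
  ring

theorem unitExp_intCast (n : ℤ) : unitExp n = 1 := by
  rw [unitExp, Complex.exp_eq_one_iff]
  exact ⟨n, by push_cast; ring⟩

theorem unitExp_add_intCast (x : ℝ) (n : ℤ) : unitExp (x + n) = unitExp x := by
  rw [unitExp_add, unitExp_intCast, mul_one]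

@[simp] theorem norm_unitExp (x : ℝ) : ‖unitExp x‖ = 1 :=
  Complex.norm_exp_ofReal_mul_I _

theorem conj_unitExp (x : ℝ) : conj (unitExp x) = unitExp (-x) := by
  rw [unitExp, unitExp, ← Complex.exp_conj, map_mul, Complex.conj_ofReal, Complex.conj_I]
  congr 1
  push_cast
  ring

theorem unitExp_eq_one_iff {x : ℝ} : unitExp x = 1 ↔ ∃ n : ℤ, x = n := by
  refine ⟨fun h => ?_, ?_⟩
  · obtain ⟨n, hn⟩ := Complex.exp_eq_one_iff.1 h
    refine ⟨n, ?_⟩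
    have h1 : (x : ℂ) * (2 * Real.pi * Complex.I) = n * (2 * Real.pi * Complex.I) := by
      rw [← hn]; push_cast; ring
    exact_mod_cast mul_right_cancel₀ Complex.two_pi_I_ne_zero h1
  · rintro ⟨n, rfl⟩
    exact unitExp_intCast n

theorem sum_unitExp_pow {M : ℕ} (hM : 0 < M) {d : ℤ} (hd : |d| < M) :
    ∑ j ∈ range M, unitExp (d / M) ^ j = if d = 0 then (M : ℂ) else 0 := by
  have hM' : (M : ℝ) ≠ 0 := by positivity
  split_ifs with h
  · simp [h]
  · rw [geom_sum_eq, ← unitExp_nat_mul, mul_div_cancel₀ _ hM', unitExp_intCast]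
    · simp
    · intro h1
      obtain ⟨n, hn⟩ := unitExp_eq_one_iff.1 h1
      rw [div_eq_iff hM'] at hn
      have hn' : d = n * M := by exact_mod_cast hn
      exact h (Int.eq_zero_of_abs_lt_dvd ⟨n, by rw [hn', mul_comm]⟩ hd)

/-- Parseval's identity for a finite family of orthogonal vectors of squared norm `w`. -/
theorem sum_norm_sq_of_orthogonal {ι κ : Type*} [Fintype ι] [Fintype κ] [DecidableEq ι]
    (v : ι → κ → ℂ) (w : ℝ)
    (hv : ∀ s s', ∑ z, v s z * conj (v s' z) = if s = s' then (w : ℂ) else 0) (A : ι → ℂ) :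
    ∑ z, ‖∑ s, A s * v s z‖ ^ 2 = w * ∑ s, ‖A s‖ ^ 2 := by
  have h : ((∑ z, ‖∑ s, A s * v s z‖ ^ 2 : ℝ) : ℂ) = ((w * ∑ s, ‖A s‖ ^ 2 : ℝ) : ℂ) := by
    push_cast
    simp only [← Complex.mul_conj', map_sum, map_mul, sum_mul_sum]
    rw [sum_comm, mul_sum]
    refine sum_congr rfl fun s _ => ?_
    rw [sum_comm]
    calc ∑ s', ∑ z, A s * v s z * (conj (A s') * conj (v s' z))
        = ∑ s', A s * conj (A s') * ∑ z, v s z * conj (v s' z) := by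
          refine sum_congr rfl fun s' _ => ?_
          rw [mul_sum]
          exact sum_congr rfl fun z _ => by ring
      _ = w * (A s * conj (A s)) := by
          simp only [hv, mul_ite, mul_zero, sum_ite_eq, mem_univ, if_true]
          ring
  exact_mod_cast h

/-! ### Phase estimation -/

/-- The amplitude of a basis state of a register with `M` basis states after phase estimation, where
`y / M` is the difference between the estimated phase and the phase that the basis state stands
for. -/
def phaseAmp (M : ℕ) (y : ℝ) : ℂ := 1 / M * ∑ j ∈ range M, unitExp (y / M) ^ j

theorem phaseAmp_zero {M : ℕ} (hM : 0 < M) : phaseAmp M 0 = 1 := by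
  have : (M : ℂ) ≠ 0 := by exact_mod_cast hM.ne'
  simp [phaseAmp, this]

theorem phaseAmp_add_int_mul {M : ℕ} (hM : 0 < M) (y : ℝ) (n : ℤ) :
    phaseAmp M (y + n * M) = phaseAmp M y := by
  have hM' : (M : ℝ) ≠ 0 := by positivity
  rw [phaseAmp, phaseAmp, add_div, mul_div_cancel_right₀ _ hM', unitExp_add_intCast]

/-- The geometric sum has numerator at most 2, and Jordan's inequality |sin θ| ≥ 2 |θ| / π bounds
its denominator below by 4 |y| / M. -/
theorem norm_phaseAmp_sq_le {M : ℕ} (hM : 0 < M) {y : ℝ} (hy : y ≠ 0) (hyM : |y| ≤ M / 2) :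
    ‖phaseAmp M y‖ ^ 2 ≤ 1 / 4 * (|y| ^ 2)⁻¹ := by
  have hMR : (0 : ℝ) < M := by exact_mod_cast hM
  have hyp : 0 < |y| := abs_pos.2 hy
  have hlow : 4 * |y| / M ≤ ‖unitExp (y / M) - 1‖ := by
    have h1 : ‖unitExp (y / M) - 1‖ = 2 * |Real.sin (Real.pi * y / M)| := by
      rw [unitExp, mul_comm _ Complex.I, Complex.norm_exp_I_mul_ofReal_sub_one, norm_mul,
        Real.norm_ofNat, Real.norm_eq_abs]
      congr 3
      ring
    have h3 : |Real.pi * y / M| = Real.pi * |y| / M := by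
      rw [abs_div, abs_mul, abs_of_pos Real.pi_pos, abs_of_pos hMR]
    have h2 : 2 / Real.pi * |Real.pi * y / M| ≤ |Real.sin (Real.pi * y / M)| := by
      apply Real.mul_abs_le_abs_sin
      rw [h3, div_le_iff₀ hMR]
      nlinarith [Real.pi_pos]
    rw [h1]
    calc 4 * |y| / M = 2 * (2 / Real.pi * |Real.pi * y / M|) := by
          rw [h3]; field_simp; ring
      _ ≤ _ := by gcongr
  have hpos : 0 < 4 * |y| / M := by positivity
  have hgeom : ‖∑ j ∈ range M, unitExp (y / M) ^ j‖ * ‖unitExp (y / M) - 1‖ ≤ 2 := by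
    rw [← norm_mul, geom_sum_mul]
    refine (norm_sub_le _ _).trans ?_
    rw [norm_pow, norm_unitExp, one_pow, norm_one]
    norm_num
  have hS : ‖∑ j ∈ range M, unitExp (y / M) ^ j‖ * (4 * |y| / M) ≤ 2 :=
    (mul_le_mul_of_nonneg_left hlow (norm_nonneg _)).trans hgeom
  have hfin : ‖phaseAmp M y‖ ≤ 1 / 2 * |y|⁻¹ := by
    rw [phaseAmp, norm_mul, norm_div, norm_one, Complex.norm_natCast]
    rw [← le_div_iff₀ hpos] at hS
    calc 1 / (M : ℝ) * ‖∑ j ∈ range M, unitExp (y / M) ^ j‖ ≤ 1 / M * (2 / (4 * |y| / M)) := by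
          gcongr
      _ = _ := by field_simp; norm_num
  calc ‖phaseAmp M y‖ ^ 2 ≤ (1 / 2 * |y|⁻¹) ^ 2 := by gcongr
    _ = _ := by rw [mul_pow, inv_pow]; norm_num

/-- Parseval: these amplitudes are the discrete Fourier transform of a unit vector. -/
theorem sum_norm_phaseAmp_sq {M : ℕ} (hM : 0 < M) (x : ℝ) :
    ∑ c : Fin M, ‖phaseAmp M (x - c)‖ ^ 2 = 1 := by
  have hMR : (M : ℝ) ≠ 0 := by positivity
  have hMC : (M : ℂ) ≠ 0 := by exact_mod_cast hM.ne'
  have h := sum_norm_sq_of_orthogonal (fun j c : Fin M => unitExp (-((j : ℕ) * ((c : ℕ) / (M : ℝ))))) M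
    (fun s s' => by
      have hd : |((s' : ℤ) - (s : ℤ))| < M := by
        have := s.2; have := s'.2
        rw [abs_lt]; constructor <;> omega
      have := sum_unitExp_pow hM hd
      rw [← Fin.sum_univ_eq_sum_range (fun j => unitExp ((((s' : ℤ) - (s : ℤ) : ℤ) : ℝ) / M) ^ j)] at this
      have e : (s = s') ↔ ((s' : ℤ) - (s : ℤ) = 0) := by
        rw [Fin.ext_iff]; omega
      simp only [e]
      rw [Complex.ofReal_natCast, ← this]
      refine sum_congr rfl fun c _ => ?_
      rw [conj_unitExp, ← unitExp_add, ← unitExp_nat_mul]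
      congr 1
      push_cast
      ring) (fun j => 1 / M * unitExp ((j : ℕ) * (x / M)))
  simp only [norm_mul, norm_unitExp, norm_div, norm_one, Complex.norm_natCast, sum_const, card_univ,
    Fintype.card_fin, nsmul_eq_mul] at h
  rw [show (M : ℝ) * (M * (1 / M * 1) ^ 2) = 1 by field_simp] at h
  rw [← h]
  refine sum_congr rfl fun c _ => ?_
  congr 2
  rw [phaseAmp, mul_sum, ← Fin.sum_univ_eq_sum_range (fun j => 1 / (M : ℂ) * unitExp ((x - c) / M) ^ j)]
  refine sum_congr rfl fun j _ => ?_
  rw [← unitExp_nat_mul, mul_assoc, ← unitExp_add]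
  congr 2
  ring

/-- Telescoping with 1 / n ^ 2 ≤ 1 / (n - 1) - 1 / n. -/
theorem sum_inv_sq_le {K : ℕ} (hK : 2 ≤ K) (S : Finset ℕ) (hS : ∀ n ∈ S, K ≤ n) :
    ∑ n ∈ S, ((n : ℝ) ^ 2)⁻¹ ≤ ((K : ℝ) - 1)⁻¹ := by
  obtain ⟨B, hB⟩ := S.exists_nat_subset_range
  have hsub : S ⊆ Ioc (K - 1) (max (K - 1) B) := by
    intro n hn
    have h1 := hS n hn
    have h2 := mem_range.1 (hB hn)
    rw [mem_Ioc]
    exact ⟨by omega, le_max_of_le_right h2.le⟩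
  refine (sum_le_sum_of_subset_of_nonneg hsub fun _ _ _ => by positivity).trans ?_
  refine (sum_Ioc_inv_sq_le_sub (by omega) (le_max_left _ _)).trans ?_
  rw [Nat.cast_sub (by omega), Nat.cast_one, sub_le_self_iff]
  positivity

/-- The points are at least 1 apart, so their floors are distinct integers. -/
theorem sum_inv_sq_le_of_injOn {ι : Type*} {K : ℕ} (hK : 2 ≤ K) (S : Finset ι) (y : ι → ℝ)
    (hy : ∀ i ∈ S, K ≤ y i) (hinj : ∀ i ∈ S, ∀ j ∈ S, |y i - y j| < 1 → i = j) :
    ∑ i ∈ S, (y i ^ 2)⁻¹ ≤ ((K : ℝ) - 1)⁻¹ := by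
  classical
  have hK0 : (0 : ℝ) < K := by positivity
  have hfl : ∀ i ∈ S, K ≤ ⌊y i⌋₊ := fun i hi => Nat.le_floor (hy i hi)
  calc ∑ i ∈ S, (y i ^ 2)⁻¹ ≤ ∑ i ∈ S, ((⌊y i⌋₊ : ℝ) ^ 2)⁻¹ := by
        refine sum_le_sum fun i hi => ?_
        have h1 : (0 : ℝ) < ⌊y i⌋₊ := hK0.trans_le (by exact_mod_cast hfl i hi)
        have h2 := Nat.floor_le (hK0.le.trans (hy i hi))
        gcongr
    _ = ∑ n ∈ S.image fun i => ⌊y i⌋₊, ((n : ℝ) ^ 2)⁻¹ := by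
        rw [sum_image]
        intro i hi j hj hij
        refine hinj i hi j hj ?_
        simp only at hij
        have h1 := Nat.floor_le (hK0.le.trans (hy i hi))
        have h2 := Nat.floor_le (hK0.le.trans (hy j hj))
        have h3 := Nat.lt_floor_add_one (y i)
        have h4 := Nat.lt_floor_add_one (y j)
        rw [hij] at h1 h3
        rw [abs_lt]; constructor <;> linarith
    _ ≤ _ := sum_inv_sq_le hK _ fun n hn => by
        obtain ⟨i, hi, rfl⟩ := mem_image.1 hn
        exact hfl i hi

/-- Phase estimation with an `M`-dimensional register yields a result at distance at least `K` from
the phase with probability at most `1 / (2 (K - 1))`. -/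
theorem sum_norm_phaseAmp_sq_le {M K : ℕ} (hM : 0 < M) (hK : 2 ≤ K) (x : ℝ) (S : Finset (Fin M))
    (hS : ∀ c ∈ S, ∀ C : ℤ, C ≡ c [ZMOD M] → (K : ℝ) ≤ |x - C|) :
    ∑ c ∈ S, ‖phaseAmp M (x - c)‖ ^ 2 ≤ 1 / (2 * ((K : ℝ) - 1)) := by
  have hMR : (0 : ℝ) < M := by exact_mod_cast hM
  have hK0 : (2 : ℝ) ≤ K := by exact_mod_cast hK
  -- `R c` is the representative of c modulo M nearest to x. The offsets y differ by integers; split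
  -- by sign, each half has spacing at least 1 in absolute value and contributes 1 / (4 (K - 1)).
  set R : Fin M → ℤ := fun c => (c : ℤ) + M * round ((x - c) / M) with hR
  set y : Fin M → ℝ := fun c => x - R c with hydef
  have hyK : ∀ c ∈ S, (K : ℝ) ≤ |y c| := fun c hc => hS c hc (R c) (by
    simp [hR, Int.ModEq])
  have hyM : ∀ c, |y c| ≤ M / 2 := fun c => by
    have h := abs_sub_round ((x - c) / M)
    have h1 : y c = M * ((x - c) / M - round ((x - c) / M)) := by
      simp only [hydef, hR]; push_cast; field_simp; ring
    rw [h1, abs_mul, abs_of_pos hMR]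
    nlinarith
  have hamp : ∀ c : Fin M, phaseAmp M (x - c) = phaseAmp M (y c) := fun c => by
    rw [← phaseAmp_add_int_mul hM (y c) (round ((x - c) / M))]
    congr 1
    simp only [hydef, hR]; push_cast; ring
  have hinj : ∀ c c' : Fin M, |y c - y c'| < 1 → c = c' := fun c c' h => by
    have h1 : y c - y c' = ((R c' - R c : ℤ) : ℝ) := by simp only [hydef]; push_cast; ring
    rw [h1, ← Int.cast_abs] at h
    have h2 : |R c' - R c| < 1 := by exact_mod_cast h
    have h3 : R c' = R c := by rw [Int.abs_lt_one_iff] at h2; omega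
    have h4 : R c' % M = R c % M := by rw [h3]
    simp only [hR, Int.add_mul_emod_self_left] at h4
    have h5 : ((c' : ℕ) : ℤ) % M = c' := Int.emod_eq_of_lt (by positivity) (by exact_mod_cast c'.2)
    have h6 : ((c : ℕ) : ℤ) % M = c := Int.emod_eq_of_lt (by positivity) (by exact_mod_cast c.2)
    rw [h5, h6] at h4
    exact Fin.ext (by exact_mod_cast h4.symm)
  have hbound : ∀ T : Finset (Fin M), T ⊆ S → (∀ c ∈ T, ∀ c' ∈ T, abs (|y c| - |y c'|) < 1 → c = c') →
      ∑ c ∈ T, ‖phaseAmp M (x - c)‖ ^ 2 ≤ 1 / 4 * ((K : ℝ) - 1)⁻¹ := fun T hT hT' => by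
    calc _ ≤ ∑ c ∈ T, 1 / 4 * (|y c| ^ 2)⁻¹ := by
          refine sum_le_sum fun c hc => ?_
          rw [hamp]
          refine norm_phaseAmp_sq_le hM (fun h0 => ?_) (hyM c)
          have := hyK c (hT hc)
          rw [h0, abs_zero] at this
          linarith
      _ ≤ _ := by
          rw [← mul_sum]
          exact mul_le_mul_of_nonneg_left
            (sum_inv_sq_le_of_injOn hK T _ (fun c hc => hyK c (hT hc)) hT') (by norm_num)
  have hpos := hbound (S.filter fun c => 0 ≤ y c) (filter_subset _ _) fun c hc c' hc' h => by
    rw [abs_of_nonneg (mem_filter.1 hc).2, abs_of_nonneg (mem_filter.1 hc').2] at h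
    exact hinj c c' h
  have hneg := hbound (S.filter fun c => ¬ 0 ≤ y c) (filter_subset _ _) fun c hc c' hc' h => by
    rw [abs_of_neg (not_le.1 (mem_filter.1 hc).2), abs_of_neg (not_le.1 (mem_filter.1 hc').2),
      neg_sub_neg] at h
    exact (hinj c' c h).symm
  rw [← sum_filter_add_sum_filter_not S fun c => 0 ≤ y c]
  refine (add_le_add hpos hneg).trans (le_of_eq ?_)
  have : (K : ℝ) - 1 ≠ 0 := by linarith
  field_simp
  norm_num

open Classical in
theorem one_sub_le_sum_isAccurate {r s l p t : ℕ} (hr : 0 < r) (hp : 1 ≤ p) :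
    1 - 1 / (2 * ((2 : ℝ) ^ p - 1)) ≤
      ∑ c ∈ univ.filter fun c : Fin (2 ^ t) => IsAccurate r s l p t c,
        ‖phaseAmp (2 ^ t) (2 ^ (t + l - 1) * (s / r) - c)‖ ^ 2 := by
  have hM : 0 < 2 ^ t := by positivity
  have hrR : (0 : ℝ) < r := by exact_mod_cast hr
  have h2p : (2 : ℝ) ≤ 2 ^ p := by
    calc (2 : ℝ) = 2 ^ 1 := (pow_one _).symm
      _ ≤ 2 ^ p := pow_le_pow_right₀ (by norm_num) hp
  rcases Nat.eq_zero_or_pos s with rfl | hs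
  -- For s = 0 the outcome 0 is certain, which yields the exactness clause of `IsAccurate`.
  · have h0 : IsAccurate r 0 l p t ((⟨0, hM⟩ : Fin (2 ^ t)) : ℕ) :=
      ⟨0, by simp [Int.ModEq], by simpa using hr, fun _ => rfl⟩
    refine le_trans ?_ (single_le_sum (f := fun c : Fin (2 ^ t) =>
      ‖phaseAmp (2 ^ t) (2 ^ (t + l - 1) * ((0 : ℕ) / (r : ℝ)) - c)‖ ^ 2)
      (fun _ _ => by positivity) (mem_filter.2 ⟨mem_univ _, h0⟩))
    simp only [Nat.cast_zero, zero_div, mul_zero, sub_zero, phaseAmp_zero hM, norm_one, one_pow]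
    rw [sub_le_self_iff]
    have : 0 ≤ (2 : ℝ) ^ p - 1 := by linarith
    positivity
  · have htot := sum_norm_phaseAmp_sq hM (2 ^ (t + l - 1) * (s / r))
    rw [← sum_filter_add_sum_filter_not univ fun c : Fin (2 ^ t) => IsAccurate r s l p t c] at htot
    have hbad := sum_norm_phaseAmp_sq_le hM (K := 2 ^ p)
      (by exact_mod_cast h2p) (2 ^ (t + l - 1) * ((s : ℝ) / r))
      (univ.filter fun c : Fin (2 ^ t) => ¬ IsAccurate r s l p t c) (fun c hc C hC => by
        by_contra hlt
        refine (mem_filter.1 hc).2 ⟨C, by exact_mod_cast hC, ?_, fun h => absurd h hs.ne'⟩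
        rw [not_le] at hlt
        have h1 : |(r : ℝ) * C - 2 ^ (t + l - 1) * s| < r * 2 ^ p := by
          calc |(r : ℝ) * C - 2 ^ (t + l - 1) * s|
              = |(-r : ℝ) * (2 ^ (t + l - 1) * (s / r) - C)| := by
                congr 1; field_simp; ring
            _ = r * |2 ^ (t + l - 1) * ((s : ℝ) / r) - C| := by
                rw [abs_mul, abs_neg, abs_of_pos hrR]
            _ < r * 2 ^ p := by
                push_cast at hlt
                gcongr
        exact_mod_cast h1)
    push_cast at hbad
    linarith

variable {L k p : ℕ}

/-! ### Product states -/

/-- The product of the states `f u` of the registers `A_{u+1}` and the state `v` of register `C`. -/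
def prodState (f : (u : Fin k) → Fin (2 ^ regSize L k p (u + 1)) → ℂ) (v : Fin (2 ^ L) → ℂ) :
    State L k p := fun c => (∏ u, f u (c.1 u)) * v c.2

theorem prod_update_left (f : (u : Fin k) → Fin (2 ^ regSize L k p (u + 1)) → ℂ) (u : Fin k)
    (g : Fin (2 ^ regSize L k p (u + 1)) → ℂ) (c : (u : Fin k) → Fin (2 ^ regSize L k p (u + 1))) :
    ∏ w, Function.update f u g w (c w) = g (c u) * ∏ w ∈ univ.erase u, f w (c w) := by
  rw [← mul_prod_erase univ _ (mem_univ u), Function.update_self]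
  congr 1
  exact prod_congr rfl fun w hw => by rw [Function.update_of_ne (ne_of_mem_erase hw)]

theorem prod_update_right (f : (u : Fin k) → Fin (2 ^ regSize L k p (u + 1)) → ℂ) (u : Fin k)
    (y : Fin (2 ^ regSize L k p (u + 1))) (c : (u : Fin k) → Fin (2 ^ regSize L k p (u + 1))) :
    ∏ w, f w (Function.update c u y w) = f u y * ∏ w ∈ univ.erase u, f w (c w) := by
  rw [← mul_prod_erase univ _ (mem_univ u), Function.update_self]
  congr 1
  exact prod_congr rfl fun w hw => by rw [Function.update_of_ne (ne_of_mem_erase hw)]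

theorem applyGate_prodState (u : Fin k)
    (G : Matrix (Fin (2 ^ regSize L k p (u + 1))) (Fin (2 ^ regSize L k p (u + 1))) ℂ)
    (f : (u : Fin k) → Fin (2 ^ regSize L k p (u + 1)) → ℂ) (v : Fin (2 ^ L) → ℂ) :
    applyGate u G (prodState f v) = prodState (Function.update f u (G.mulVec (f u))) v := by
  funext c
  simp only [applyGate, prodState, prod_update_left, prod_update_right, Matrix.mulVec, dotProduct,
    sum_mul]
  exact sum_congr rfl fun y _ => by ring

theorem pow_mulVec_of_eigenvector {n : Type*} [Fintype n] [DecidableEq n] {U : Matrix n n ℂ}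
    {v : n → ℂ} {μ : ℂ} (h : U.mulVec v = μ • v) (j : ℕ) : (U ^ j).mulVec v = μ ^ j • v := by
  induction j with
  | zero => simp
  | succ j ih => rw [pow_succ, ← Matrix.mulVec_mulVec, h, Matrix.mulVec_smul, ih, smul_smul, pow_succ']

/-- Phase kickback: C stays in its eigenvector, and the eigenvalue powers become phases of the
control register. -/
theorem applyControlled_prodState (u : Fin k) {U : Matrix (Fin (2 ^ L)) (Fin (2 ^ L)) ℂ}
    (f : (u : Fin k) → Fin (2 ^ regSize L k p (u + 1)) → ℂ) {v : Fin (2 ^ L) → ℂ} {μ : ℂ}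
    (h : U.mulVec v = μ • v) :
    applyControlled u U (prodState f v) =
      prodState (Function.update f u fun j => μ ^ (j : ℕ) * f u j) v := by
  funext c
  have h1 := congrFun (pow_mulVec_of_eigenvector h (c.1 u)) c.2
  simp only [Matrix.mulVec, dotProduct, Pi.smul_apply, smul_eq_mul] at h1
  simp only [applyControlled, prodState, prod_update_left]
  calc _ = (∏ w, f w (c.1 w)) * ∑ x, (U ^ (c.1 u : ℕ)) c.2 x * v x := by
        rw [mul_sum]
        exact sum_congr rfl fun x _ => by ring
    _ = _ := by
        rw [h1, ← mul_prod_erase univ _ (mem_univ u)]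
        ring

theorem applyGate_sum {ι : Type*} (S : Finset ι) (u : Fin k)
    (G : Matrix (Fin (2 ^ regSize L k p (u + 1))) (Fin (2 ^ regSize L k p (u + 1))) ℂ)
    (φ : ι → State L k p) : applyGate u G (∑ i ∈ S, φ i) = ∑ i ∈ S, applyGate u G (φ i) := by
  funext c
  simp only [applyGate, Finset.sum_apply, mul_sum]
  exact sum_comm

theorem applyControlled_sum {ι : Type*} (S : Finset ι) (u : Fin k)
    (U : Matrix (Fin (2 ^ L)) (Fin (2 ^ L)) ℂ) (φ : ι → State L k p) :
    applyControlled u U (∑ i ∈ S, φ i) = ∑ i ∈ S, applyControlled u U (φ i) := by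
  funext c
  simp only [applyControlled, Finset.sum_apply, mul_sum]
  exact sum_comm

theorem foldl_nodeStep_sum {ι : Type*} (N a : ℕ) (S : Finset ι) (us : List (Fin k))
    (φ : ι → State L k p) :
    us.foldl (fun φ u => nodeStep N a u φ) (∑ i ∈ S, φ i) =
      ∑ i ∈ S, us.foldl (fun φ u => nodeStep N a u φ) (φ i) := by
  induction us generalizing φ with
  | nil => rfl
  | cons u us ih =>
    simp only [List.foldl_cons]
    rw [← ih]
    simp only [nodeStep, applyGate_sum, applyControlled_sum]

/-! ### Phase estimation on one register -/

/-- The basis state `|0⟩` of a register. -/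
def zeroState (t : ℕ) : Fin (2 ^ t) → ℂ := fun j => if (j : ℕ) = 0 then 1 else 0

theorem hadamard_mulVec_zeroState (t : ℕ) :
    (hadamard t).mulVec (zeroState t) = fun _ => 1 / (√(2 ^ t) : ℂ) := by
  funext c
  have h0 : ∀ j : Fin (2 ^ t), (j : ℕ) = 0 ↔ j = ⟨0, by positivity⟩ := fun j => by
    rw [Fin.ext_iff]
  have hs : (√2 : ℝ) ^ t = √(2 ^ t) := (Real.sqrt_eq_iff_mul_self_eq (by positivity) (by positivity)).2
    (by rw [← mul_pow, Real.mul_self_sqrt (by norm_num)]) |>.symm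
  simp only [Matrix.mulVec, dotProduct, zeroState, h0, mul_ite, mul_one, mul_zero, sum_ite_eq',
    mem_univ, if_true, hadamard, Nat.zero_testBit, Bool.false_eq_true, and_false, if_false,
    prod_const, card_univ, Fintype.card_fin]
  rw [div_pow, one_pow, ← hs]
  push_cast
  rfl

theorem qftInv_mulVec_pow (t : ℕ) (x : ℝ) :
    (qftInv t).mulVec (fun j => unitExp x ^ (j : ℕ) * (1 / (√(2 ^ t) : ℂ))) =
      fun c : Fin (2 ^ t) => phaseAmp (2 ^ t) (2 ^ t * x - (c : ℕ)) := by
  funext c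
  have h1 : ((√(2 ^ t : ℝ) : ℝ) : ℂ) * (√(2 ^ t : ℝ) : ℝ) = 2 ^ t := by
    rw [← Complex.ofReal_mul, Real.mul_self_sqrt (by positivity)]; norm_num
  have h2 : (2 ^ t : ℝ) ≠ 0 := by positivity
  simp only [Matrix.mulVec, dotProduct, phaseAmp, mul_sum]
  rw [← Fin.sum_univ_eq_sum_range
    (fun j => 1 / ((2 ^ t : ℕ) : ℂ) * unitExp ((2 ^ t * x - (c : ℕ)) / (2 ^ t : ℕ)) ^ j)]
  refine sum_congr rfl fun j _ => ?_
  have h3 : qftInv t c j = 1 / (√(2 ^ t) : ℂ) * unitExp (-((j : ℕ) * ((c : ℕ) / 2 ^ t))) := by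
    rw [← conj_unitExp, unitExp]
    simp only [qftInv, qft, Matrix.conjTranspose_apply, star_mul', RCLike.star_def, map_div₀, map_one,
      Complex.conj_ofReal]
    congr 3
    push_cast
    ring
  rw [h3, ← unitExp_nat_mul, ← unitExp_nat_mul]
  calc _ = 1 / ((√(2 ^ t : ℝ) : ℝ) * (√(2 ^ t : ℝ) : ℝ) : ℂ) *
        (unitExp (-((j : ℕ) * ((c : ℕ) / 2 ^ t))) * unitExp ((j : ℕ) * x)) := by
        field_simp
    _ = _ := by
        rw [h1, ← unitExp_add]
        push_cast
        congr 2
        field_simp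
        ring

theorem nodeStep_prodState {N a : ℕ} (u : Fin k)
    (f : (u : Fin k) → Fin (2 ^ regSize L k p (u + 1)) → ℂ) (hf : f u = zeroState _)
    {v : Fin (2 ^ L) → ℂ} {x : ℝ} (h : (modMul N a L).mulVec v = unitExp x • v) :
    nodeStep N a u (prodState f v) = prodState (Function.update f u fun c =>
      phaseAmp (2 ^ regSize L k p (u + 1))
        (2 ^ regSize L k p (u + 1) * (2 ^ (l L k (u + 1) - 1) * x) - c)) v := by
  have h2 : (modMul N a L ^ 2 ^ (l L k (u + 1) - 1)).mulVec v =
      unitExp (2 ^ (l L k (u + 1) - 1) * x) • v := by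
    rw [pow_mulVec_of_eigenvector h, ← unitExp_nat_mul]
    push_cast
    rfl
  rw [nodeStep, applyGate_prodState, hf, hadamard_mulVec_zeroState,
    applyControlled_prodState _ _ h2, applyGate_prodState]
  simp only [Function.update_self, Function.update_idem, qftInv_mulVec_pow]

/-- Since C returns unchanged after each step, the registers never become entangled; `Nodup` ensures
that each one is still in the zero state at its turn. -/
theorem foldl_nodeStep_prodState {N a : ℕ} {v : Fin (2 ^ L) → ℂ} {x : ℝ}
    (h : (modMul N a L).mulVec v = unitExp x • v) (us : List (Fin k)) (hus : us.Nodup)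
    (f : (u : Fin k) → Fin (2 ^ regSize L k p (u + 1)) → ℂ) (hf : ∀ u ∈ us, f u = zeroState _) :
    us.foldl (fun φ u => nodeStep N a u φ) (prodState f v) = prodState (fun u =>
      if u ∈ us then fun c => phaseAmp (2 ^ regSize L k p (u + 1))
        (2 ^ regSize L k p (u + 1) * (2 ^ (l L k (u + 1) - 1) * x) - c) else f u) v := by
  induction us generalizing f with
  | nil => simp
  | cons u us ih =>
    obtain ⟨hu, hus⟩ := List.nodup_cons.1 hus
    rw [List.foldl_cons, nodeStep_prodState u f (hf u (by simp)) h, ih hus]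
    · congr 1
      funext w
      by_cases hw : w = u
      · subst hw
        simp [hu]
      · simp [hw]
    · intro w hw
      have hwu : w ≠ u := fun e => hu (e ▸ hw)
      rw [Function.update_of_ne hwu, hf w (by simp [hw])]

/-! ### Eigenvectors of modular multiplication -/

/-- The eigenvector of `modMul N a L` for the eigenvalue `exp (2 π i s / r)`, where `r` is the order
of `a` modulo `N`, scaled by `1 / √r`. -/
def eigenvector (N a L r s : ℕ) : Fin (2 ^ L) → ℂ := fun z =>
  1 / r * ∑ j ∈ range r, unitExp (-(s / r)) ^ j * if (z : ℕ) = a ^ j % N then 1 else 0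

variable {N a r : ℕ}

theorem modMul_mulVec_eigenvector (hN : 0 < N) (hNL : N ≤ 2 ^ L) (hr : 0 < r)
    (har : a ^ r % N = 1 % N) (s : ℕ) :
    (modMul N a L).mulVec (eigenvector N a L r s) =
      unitExp (s / r) • eigenvector N a L r s := by
  funext z
  have hrR : (r : ℝ) ≠ 0 := by positivity
  have h1 : ∀ j, ∑ x : Fin (2 ^ L), modMul N a L z x * (if (x : ℕ) = a ^ j % N then 1 else 0) =
      if (z : ℕ) = a ^ (j + 1) % N then 1 else 0 := fun j => by
    have hlt : a ^ j % N < N := Nat.mod_lt _ hN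
    have hx : ∀ x : Fin (2 ^ L), (x : ℕ) = a ^ j % N ↔ x = ⟨a ^ j % N, hlt.trans_le hNL⟩ := fun x => by
      rw [Fin.ext_iff]
    simp only [hx, mul_ite, mul_one, mul_zero, sum_ite_eq', mem_univ, if_true, modMul, hlt]
    rw [Nat.mul_mod_mod, ← pow_succ']
  -- Multiplication by a shifts the orbit cyclically: the terms for j = 0 and j = r agree.
  have hshift : ∑ j ∈ range r, unitExp (-(s / r)) ^ (j + 1) *
        (if (z : ℕ) = a ^ (j + 1) % N then (1 : ℂ) else 0) =
      ∑ j ∈ range r, unitExp (-(s / r)) ^ j * if (z : ℕ) = a ^ j % N then 1 else 0 := by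
    have e1 : unitExp (-(s / r)) ^ r = 1 := by
      rw [← unitExp_nat_mul, mul_neg, mul_div_cancel₀ _ hrR]
      exact_mod_cast unitExp_intCast (-s)
    have h2 := sum_range_succ (fun j => unitExp (-(s / r)) ^ j *
      if (z : ℕ) = a ^ j % N then (1 : ℂ) else 0) r
    rw [sum_range_succ', e1, har, pow_zero, pow_zero] at h2
    exact add_right_cancel h2
  have hinv : unitExp (s / r) * unitExp (-(s / r)) = 1 := by
    rw [← unitExp_add, add_neg_cancel, unitExp_zero]
  calc (modMul N a L).mulVec (eigenvector N a L r s) z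
      = 1 / r * ∑ j ∈ range r, unitExp (-(s / r)) ^ j *
          ∑ x : Fin (2 ^ L), modMul N a L z x * (if (x : ℕ) = a ^ j % N then 1 else 0) := by
        simp only [Matrix.mulVec, dotProduct, eigenvector, mul_sum]
        rw [sum_comm]
        exact sum_congr rfl fun j _ => sum_congr rfl fun x _ => by ring
    _ = unitExp (s / r) * (1 / r * ∑ j ∈ range r, unitExp (-(s / r)) ^ (j + 1) *
          if (z : ℕ) = a ^ (j + 1) % N then 1 else 0) := by
        simp only [h1, mul_sum]
        refine sum_congr rfl fun j _ => ?_
        rw [pow_succ (unitExp _)]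
        linear_combination (-(1 / (r : ℂ) * unitExp (-(s / r)) ^ j *
          if (z : ℕ) = a ^ (j + 1) % N then 1 else 0)) * hinv
    _ = _ := by
        rw [hshift]
        rfl

theorem sum_eigenvector (hr : 0 < r) (z : Fin (2 ^ L)) :
    ∑ s : Fin r, eigenvector N a L r s z = if (z : ℕ) = 1 % N then 1 else 0 := by
  have hrR : (r : ℝ) ≠ 0 := by positivity
  have hrC : (r : ℂ) ≠ 0 := by exact_mod_cast hr.ne'
  simp only [eigenvector, ← mul_sum]
  rw [sum_comm]
  have h1 : ∀ j ∈ range r, ∑ s : Fin r, unitExp (-((s : ℕ) / r)) ^ j *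
      (if (z : ℕ) = a ^ j % N then (1 : ℂ) else 0) =
      if j = 0 then r * (if (z : ℕ) = 1 % N then (1 : ℂ) else 0) else 0 := fun j hj => by
    have hj' : |(-j : ℤ)| < r := by
      rw [abs_neg, Nat.abs_cast]; exact_mod_cast mem_range.1 hj
    have h2 := sum_unitExp_pow hr hj'
    rw [← Fin.sum_univ_eq_sum_range (fun s => unitExp (((-j : ℤ) : ℝ) / r) ^ s)] at h2
    rw [← sum_mul]
    have h3 : ∑ s : Fin r, unitExp (-((s : ℕ) / r)) ^ j =
        ∑ s : Fin r, unitExp (((-j : ℤ) : ℝ) / r) ^ (s : ℕ) :=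
      sum_congr rfl fun s _ => by
        rw [← unitExp_nat_mul, ← unitExp_nat_mul]
        congr 1
        push_cast
        ring
    rw [h3, h2]
    by_cases h0 : j = 0
    · simp [h0]
    · simp [h0]
  rw [sum_congr rfl h1, sum_ite_eq', if_pos (mem_range.2 hr), ← mul_assoc, one_div,
    inv_mul_cancel₀ hrC, one_mul]

theorem eigenvector_orthogonal (hN : 0 < N) (hNL : N ≤ 2 ^ L) (hr : 0 < r)
    (hinj : ∀ i < r, ∀ j < r, a ^ i % N = a ^ j % N → i = j) (s s' : Fin r) :
    ∑ z, eigenvector N a L r s z * conj (eigenvector N a L r s' z) =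
      if s = s' then (((1 / r : ℝ)) : ℂ) else 0 := by
  have hrC : (r : ℂ) ≠ 0 := by exact_mod_cast hr.ne'
  have hd : |((s' : ℤ) - (s : ℤ))| < r := by
    have := s.2; have := s'.2
    rw [abs_lt]; constructor <;> omega
  have hsum := sum_unitExp_pow hr hd
  have e : (s = s') ↔ ((s' : ℤ) - (s : ℤ) = 0) := by
    rw [Fin.ext_iff]; omega
  have hind : ∀ i ∈ range r, ∀ j ∈ range r,
      ∑ z : Fin (2 ^ L), (if (z : ℕ) = a ^ i % N then (1 : ℂ) else 0) *
        (if (z : ℕ) = a ^ j % N then 1 else 0) = if i = j then 1 else 0 := fun i hi j hj => by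
    have hlt : a ^ i % N < N := Nat.mod_lt _ hN
    have hz : ∀ z : Fin (2 ^ L), (z : ℕ) = a ^ i % N ↔ z = ⟨a ^ i % N, hlt.trans_le hNL⟩ := fun z => by
      rw [Fin.ext_iff]
    simp only [hz, ite_mul, one_mul, zero_mul, sum_ite_eq', mem_univ, if_true]
    have : a ^ i % N = a ^ j % N ↔ i = j :=
      ⟨hinj i (mem_range.1 hi) j (mem_range.1 hj), fun h => by rw [h]⟩
    simp only [this]
  calc ∑ z, eigenvector N a L r s z * conj (eigenvector N a L r s' z)
      = 1 / (r * r) * ∑ i ∈ range r, ∑ j ∈ range r,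
          unitExp (-((s : ℕ) / r)) ^ i * unitExp ((s' : ℕ) / r) ^ j *
          ∑ z : Fin (2 ^ L), (if (z : ℕ) = a ^ i % N then (1 : ℂ) else 0) *
            (if (z : ℕ) = a ^ j % N then 1 else 0) := by
        simp only [eigenvector, map_mul, map_sum, map_div₀, map_one, map_pow, conj_unitExp, neg_neg,
          map_natCast, apply_ite conj, map_zero]
        simp only [mul_sum, sum_mul]
        rw [sum_comm]
        rw [sum_congr rfl fun i _ => sum_comm, sum_comm]
        refine sum_congr rfl fun i _ => sum_congr rfl fun j _ => sum_congr rfl fun z _ => ?_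
        field_simp
    _ = 1 / (r * r) * ∑ i ∈ range r, unitExp ((((s' : ℤ) - (s : ℤ) : ℤ) : ℝ) / r) ^ i := by
        congr 1
        refine sum_congr rfl fun i hi => ?_
        rw [sum_congr rfl fun j hj => by rw [hind i hi j hj]]
        simp only [mul_ite, mul_one, mul_zero, sum_ite_eq, hi, if_true]
        rw [← mul_pow, ← unitExp_add]
        congr 2
        push_cast
        ring
    _ = _ := by
        rw [hsum]
        simp only [← e]
        split_ifs
        · push_cast
          field_simp
        · simp

/-! ### The order of `a` modulo `N` -/

theorem exists_unit_of_gcd_eq_one (hcop : Nat.gcd N a = 1) :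
    ∃ u : (ZMod N)ˣ, (u : ZMod N) = a ∧ orderOf u = orderOf (a : ZMod N) := by
  refine ⟨ZMod.unitOfCoprime a (Nat.Coprime.symm hcop), ZMod.coe_unitOfCoprime _ _, ?_⟩
  rw [← orderOf_units, ZMod.coe_unitOfCoprime]

theorem orderOf_natCast_pos (hN : 0 < N) (hcop : Nat.gcd N a = 1) : 0 < orderOf (a : ZMod N) := by
  have : NeZero N := ⟨hN.ne'⟩
  obtain ⟨u, -, hu⟩ := exists_unit_of_gcd_eq_one hcop
  rw [← hu]
  exact orderOf_pos u

theorem orderOf_natCast_le (hN : 0 < N) (hcop : Nat.gcd N a = 1) : orderOf (a : ZMod N) ≤ N := by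
  have : NeZero N := ⟨hN.ne'⟩
  obtain ⟨u, -, hu⟩ := exists_unit_of_gcd_eq_one hcop
  rw [← hu]
  refine orderOf_le_card_univ.trans ?_
  rw [ZMod.card_units_eq_totient]
  exact Nat.totient_le N

theorem pow_orderOf_mod (N a : ℕ) : a ^ orderOf (a : ZMod N) % N = 1 % N := by
  have h := pow_orderOf_eq_one (a : ZMod N)
  rw [← Nat.cast_pow, ← Nat.cast_one, ZMod.natCast_eq_natCast_iff'] at h
  exact h

theorem pow_mod_injOn (hcop : Nat.gcd N a = 1) :
    ∀ i < orderOf (a : ZMod N), ∀ j < orderOf (a : ZMod N), a ^ i % N = a ^ j % N → i = j := by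
  obtain ⟨u, hu, ho⟩ := exists_unit_of_gcd_eq_one hcop
  intro i hi j hj h
  rw [← ZMod.natCast_eq_natCast_iff', Nat.cast_pow, Nat.cast_pow, ← hu] at h
  rw [← ho] at hi hj
  exact pow_injOn_Iio_orderOf hi hj (Units.ext (by simpa using h))

/-! ### The state before the measurement -/

/-- The state of register `A_{u+1}` before the measurement, if register `C` is in the eigenvector
number `s`. -/
def registerState (L k p r s : ℕ) (u : Fin k) : Fin (2 ^ regSize L k p (u + 1)) → ℂ := fun c =>
  phaseAmp (2 ^ regSize L k p (u + 1))
    (2 ^ regSize L k p (u + 1) * (2 ^ (l L k (u + 1) - 1) * (s / r)) - c)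

theorem initialState_eq_sum {r : ℕ} (hr : 0 < r) (hN : 1 < N) :
    initialState L k p = ∑ s : Fin r, prodState (fun _ => zeroState _) (eigenvector N a L r s) := by
  funext c
  simp only [Finset.sum_apply, prodState, ← mul_sum, sum_eigenvector hr, Nat.mod_eq_of_lt hN,
    initialState, zeroState, Finset.prod_ite_zero, mem_univ, true_imp_iff, prod_const_one]
  split_ifs <;> simp_all

theorem finalState_eq_sum {r : ℕ} (hr : 0 < r) (hN : 1 < N) (hNL : N ≤ 2 ^ L)
    (har : a ^ r % N = 1 % N) :
    finalState N a L k p =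
      ∑ s : Fin r, prodState (registerState L k p r s) (eigenvector N a L r s) := by
  rw [finalState, initialState_eq_sum (a := a) hr hN, foldl_nodeStep_sum]
  refine sum_congr rfl fun s _ => ?_
  rw [foldl_nodeStep_prodState (modMul_mulVec_eigenvector (by omega) hNL hr har s) _
    (List.nodup_finRange k) _ fun _ _ => rfl]
  simp only [List.mem_finRange, if_true]
  rfl

-- The readout ignores C, so summing over C removes the cross terms between orthogonal eigenvectors.
open Classical in
theorem prob_finalState {r : ℕ} (hr : 0 < r) (hN : 1 < N) (hNL : N ≤ 2 ^ L)
    (har : a ^ r % N = 1 % N) (hinj : ∀ i < r, ∀ j < r, a ^ i % N = a ^ j % N → i = j)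
    (E : (ℕ → ℕ) → Prop) :
    prob (finalState N a L k p) E = 1 / r * ∑ s : Fin r,
      ∑ c : (u : Fin k) → Fin (2 ^ regSize L k p (u + 1)) with
        E (readout ((c, ⟨0, by positivity⟩) : Basis L k p)),
        ∏ u, ‖registerState L k p r s u (c u)‖ ^ 2 := by
  have h : ∀ c : (u : Fin k) → Fin (2 ^ regSize L k p (u + 1)),
      ∑ z, ‖finalState N a L k p (c, z)‖ ^ 2 =
        1 / r * ∑ s : Fin r, ∏ u, ‖registerState L k p r s u (c u)‖ ^ 2 := fun c => by
    simp only [finalState_eq_sum hr hN hNL har, Finset.sum_apply, prodState]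
    rw [sum_norm_sq_of_orthogonal (fun s : Fin r => eigenvector N a L r s) (1 / r)
      (eigenvector_orthogonal (by omega) hNL hr hinj)]
    simp only [norm_prod, prod_pow]
  rw [prob, sum_filter, Fintype.sum_prod_type, sum_comm, mul_sum]
  simp only [sum_filter, mul_sum]
  rw [sum_comm, sum_comm (s := (univ : Finset (Fin r)))]
  refine sum_congr rfl fun c _ => ?_
  have hE : ∀ z, readout ((c, z) : Basis L k p) = readout ((c, ⟨0, by positivity⟩) : Basis L k p) :=
    fun _ => rfl
  simp only [hE]
  split_ifs
  · rw [h, mul_sum]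
  · simp

/-! ### The success probability -/

theorem two_add_le_two_pow_extraQubits (k : ℕ) {ε : ℝ} (hε : 0 < ε) :
    2 + 1 / (2 * (ε / k)) ≤ (2 : ℝ) ^ extraQubits k ε := by
  have h0 : 0 < 2 + 1 / (2 * (ε / k)) := by positivity
  have h := Nat.le_ceil (Real.logb 2 (2 + 1 / (2 * (ε / k))))
  rw [Real.logb_le_iff_le_rpow (by norm_num) h0, Real.rpow_natCast] at h
  exact h

open Classical in
theorem one_sub_le_sum_registerState {r s : ℕ} (hr : 0 < r) (hk : 0 < k) {ε : ℝ} (hε : 0 < ε)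
    (u : Fin k) :
    1 - ε / k ≤ ∑ c ∈ univ.filter fun c : Fin (2 ^ regSize L k (extraQubits k ε) (u + 1)) =>
        IsAccurate r s (l L k (u + 1)) (extraQubits k ε)
          (regSize L k (extraQubits k ε) (u + 1)) c,
        ‖registerState L k (extraQubits k ε) r s u c‖ ^ 2 := by
  have hδ : 0 < ε / k := by positivity
  have h2 := two_add_le_two_pow_extraQubits k hε
  have h3 : 0 < 1 / (2 * (ε / k)) := by positivity
  have hp : 1 ≤ extraQubits k ε := by
    by_contra h
    rw [show extraQubits k ε = 0 by omega, pow_zero] at h2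
    linarith
  have hb : 1 / (2 * ((2 : ℝ) ^ extraQubits k ε - 1)) ≤ ε / k := by
    rw [div_le_iff₀ (by linarith)]
    have h4 : 1 / (2 * (ε / k)) * (2 * (ε / k)) = 1 := by field_simp
    nlinarith
  have hmain := one_sub_le_sum_isAccurate (s := s) (l := l L k (u + 1))
    (t := regSize L k (extraQubits k ε) (u + 1)) hr hp
  have hl := l_pos L k (u + 1) u.2
  -- Here l ≥ 1 keeps the natural subtraction exact, turning 2 ^ (t + l - 1) into the factors used
  -- in `registerState`.
  rw [Nat.add_sub_assoc hl, pow_add, mul_assoc] at hmain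
  refine le_trans ?_ hmain
  linarith

open Classical in
theorem one_sub_le_sum_prod_registerState {r s : ℕ} (hr : 0 < r) (hk : 0 < k) {ε : ℝ}
    (hε : 0 < ε) (E : (ℕ → ℕ) → Prop)
    (hE : ∀ c : Basis L k (extraQubits k ε), (∀ u : Fin k, IsAccurate r s (l L k (u + 1))
      (extraQubits k ε) (regSize L k (extraQubits k ε) (u + 1)) (c.1 u)) → E (readout c)) :
    1 - ε ≤ ∑ c : (u : Fin k) → Fin (2 ^ regSize L k (extraQubits k ε) (u + 1)) with
        E (readout ((c, ⟨0, by positivity⟩) : Basis L k (extraQubits k ε))),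
        ∏ u, ‖registerState L k (extraQubits k ε) r s u (c u)‖ ^ 2 := by
  have hkR : (0 : ℝ) < k := by exact_mod_cast hk
  -- For ε ≥ 1 the bound is trivial; otherwise 1 - ε / k is nonnegative, as the product comparison
  -- needs.
  rcases le_or_gt 1 ε with h1 | h1
  · exact le_trans (by linarith) (sum_nonneg fun _ _ => prod_nonneg fun _ _ => by positivity)
  · have hδ : ε / k ≤ ε := div_le_self hε.le (by exact_mod_cast hk)
    calc 1 - ε = 1 + k * (-(ε / k)) := by field_simp; ring
      _ ≤ (1 + -(ε / k)) ^ k := one_add_mul_le_pow (by linarith) k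
      _ = ∏ u : Fin k, (1 - ε / k) := by simp [sub_eq_add_neg]
      _ ≤ ∏ u : Fin k, _ :=
          prod_le_prod (fun _ _ => by linarith)
            fun u _ => one_sub_le_sum_registerState (L := L) (s := s) hr hk hε u
      _ ≤ _ := by
          -- The product of the accuracy probabilities is the weight of the box of jointly accurate
          -- outcomes, which lies inside the event.
          rw [prod_univ_sum]
          refine sum_le_sum_of_subset_of_nonneg (fun c hc => ?_)
            fun _ _ _ => prod_nonneg fun _ _ => by positivity
          rw [Fintype.mem_piFinset] at hc
          exact mem_filter.2 ⟨mem_univ _, hE _ fun u => (mem_filter.1 (hc u)).2⟩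

end

end DistributedOrderFinding

open DistributedOrderFinding in
theorem mainTheorem1 (N a L k : ℕ) (ε : ℝ)
    (ha : 0 < a) (haN : a < N) (hcop : Nat.gcd N a = 1)
    (hL : 2 ^ (L - 1) ≤ N ∧ N < 2 ^ L)
    (hk : 0 < k) (hkL : k ∣ L) (hε : 0 < ε) :
    1 - ε ≤
      prob (finalState N a L k (extraQubits k ε)) (fun results =>
        ∃ m, combineResults L k (extraQubits k ε) results = some m ∧
          IsGoodEstimate L (extraQubits k ε) (orderOf (a : ZMod N)) m) := by
  have hN : 1 < N := by omega
  have hL0 : 0 < L := Nat.pos_of_ne_zero fun h => by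
    rw [h, pow_zero] at hL
    omega
  have hr := orderOf_natCast_pos (by omega : 0 < N) hcop
  have hrN := orderOf_natCast_le (by omega : 0 < N) hcop
  rw [prob_finalState hr hN hL.2.le (pow_orderOf_mod N a) (pow_mod_injOn hcop)]
  have hrR : (0 : ℝ) < orderOf (a : ZMod N) := by exact_mod_cast hr
  rw [one_div, ← div_eq_inv_mul, le_div_iff₀ hrR]
  -- The bound holds for every s separately, hence for the average over s.
  refine le_trans (le_of_eq ?_) (Finset.sum_le_sum (f := fun _ => 1 - ε) fun s _ =>
    one_sub_le_sum_prod_registerState (L := L) (s := (s : ℕ)) hr hk hε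
      (fun results => ∃ m, combineResults L k (extraQubits k ε) results = some m ∧
        IsGoodEstimate L (extraQubits k ε) (orderOf (a : ZMod N)) m) fun c hc =>
      combineResults_isGoodEstimate hL0 hk hkL (hrN.trans_lt hL.2) s.2 c hc)
  rw [Finset.sum_const, Finset.card_univ, Fintype.card_fin, nsmul_eq_mul, mul_comm]
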